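/- Let $E,J,R\in\mathbb C^{n\times n}$ and $B\in\mathbb C^{n\times m}$ with $E=E^H\ge 0$, $R=R^H\ge 0$ and $J=-J^H$ (the coefficients of the port-Hamiltonian descriptor system $E\dot x=(J-R)x+Bu$, $y=B^Hx$). A pencil $\lambda\mathcal E-A$ with $\mathcal E,A\in\mathbb C^{n\times n}$, also written $(\mathcal E,A)$, is called regular if $\det(\lambda_0\mathcal E-A)\neq 0$ for some $\lambda_0\in\mathbb C$; its index is then the size of the largest nilpotent block $\lambda N-I$ ($N$ a nilpotent Jordan block) in its Kronecker (Weierstrass) canonical form, and is $0$ if there is no such block, i.e. if $\mathcal E$ is invertible. For a matrix $M$, let $\mathcal S_\infty(M)$ denote any matrix of full column rank whose columns span the right nullspace of $M$. Then $$\operatorname{rank}\begin{bmatrix}E & B\end{bmatrix}=\max_{\hat K\in\mathbb C^{m\times m}}\operatorname{rank}(E+B\hat KB^H),$$ and there exists a matrix $K\in\mathbb C^{m\times m}$ such that $E+BKB^H\ge 0$ (Hermitian positive semidefinite), the pencil $(E+BKB^H,\,J-R)$ is regular and of index at most one, and $$\operatorname{rank}(E+BKB^H)=\operatorname{rank}\begin{bmatrix}E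 & B\end{bmatrix}$$ if and only if $$\operatorname{rank}\begin{bmatrix}E & (J-R)\,\mathcal S_\infty\!\left(\begin{bmatrix}E\\ B^H\end{bmatrix}\right) & B\end{bmatrix}=n.$$ -/

import Mathlib

open scoped Matrix ComplexOrder

namespace PHDAE

/-- The pencil `λ E - A` is regular: `det (λ₀ E - A) ≠ 0` for some complex `λ₀`. -/
def IsRegularPencil {n : ℕ} (E A : Matrix (Fin n) (Fin n) ℂ) : Prop :=
  ∃ z : ℂ, (z • E - A).det ≠ 0

/-- The nilpotent Jordan block of size `s`: ones on the first superdiagonal, zeros elsewhere. -/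
def nilpotentBlock (s : ℕ) : Matrix (Fin s) (Fin s) ℂ :=
  Matrix.of fun i j => if (i : ℕ) + 1 = (j : ℕ) then 1 else 0

/-- The square pencil `λ E - A` is brought by the nonsingular matrices `S`, `T` (and the
identification `e` of its index set with that of a block matrix) to the Weierstrass form
`diag (λ I - C, λ N₁ - I, …, λ N_r - I)`, where `N_j` is the nilpotent Jordan block of size
`σ j ≥ 1`. The finite part `C` need not be in Jordan form: a further change of basis achieves
this without touching the blocks `N_j`. -/
structure IsWeierstrassForm {n p r : ℕ} (E A : Matrix (Fin n) (Fin n) ℂ)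
    (S T : Matrix (Fin n) (Fin n) ℂ) (C : Matrix (Fin p) (Fin p) ℂ) (σ : Fin r → ℕ)
    (e : Fin n ≃ Fin p ⊕ (Σ j : Fin r, Fin (σ j))) : Prop where
  isUnit_left : IsUnit S
  isUnit_right : IsUnit T
  size_pos : ∀ j, 1 ≤ σ j
  leading : Matrix.reindex e e (S * E * T) =
    Matrix.fromBlocks 1 0 0 (Matrix.blockDiagonal' fun j => nilpotentBlock (σ j))
  constant : Matrix.reindex e e (S * A * T) = Matrix.fromBlocks C 0 0 1

/-- The regular pencil `λ E - A` has index `ν`: `ν` is the size of the largest nilpotent block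
`λ N_j - I` in its Weierstrass form, and `ν = 0` if there is no such block (that is, if `E` is
invertible). -/
def HasIndex {n : ℕ} (E A : Matrix (Fin n) (Fin n) ℂ) (ν : ℕ) : Prop :=
  ∃ (p r : ℕ) (S T : Matrix (Fin n) (Fin n) ℂ) (C : Matrix (Fin p) (Fin p) ℂ)
    (σ : Fin r → ℕ) (e : Fin n ≃ Fin p ⊕ (Σ j : Fin r, Fin (σ j))),
    IsWeierstrassForm E A S T C σ e ∧ ν = Finset.univ.sup σ

/-- `S` is a matrix of full column rank whose columns span the right nullspace of `M`. -/
def IsNullspaceMatrix {ι : Type*} {n k : ℕ} (M : Matrix ι (Fin n) ℂ)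
    (S : Matrix (Fin n) (Fin k) ℂ) : Prop :=
  S.rank = k ∧ Submodule.span ℂ (Set.range S.col) = LinearMap.ker M.mulVecLin

end PHDAE

/-! Write `F = E + B K Bᴴ` and `A = J - R`. The pencil `(F, A)` is regular of index at most one
exactly when `range F + A (ker F)` is the whole space
(`isRegularPencil_and_hasIndex_of_forall_exists`, `HasIndex.exists_mulVec_add_mulVec`). If `F` has
the rank of `[E B]`, then `range F = range [E B]`, because `F` factors through `[E B]`, and `ker F =
ker [E; Bᴴ]`, by inclusion and a dimension count using `E = Eᴴ`. The spanning condition is then the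
stated rank condition (`rank_fromCols_eq_iff`), whatever `K` is. Finally `K = 1` is positive
semidefinite feedback attaining the maximal rank (`rank_add_mul_conjTranspose`). -/

open Matrix Module

namespace PHDAE

/-! ### Splitting a pair of linear maps into finite and infinite parts -/

section LinearMaps

variable {F V : Type*} [Field F] [AddCommGroup V] [Module F V] [FiniteDimensional F V]

/-- If the range of `f` and the image of `ker f` under `g` span the space, then they do so as a
direct sum, and `g` is injective on `ker f`. -/
theorem eq_zero_of_apply_add_apply_eq_zero {f g : V →ₗ[F] V}
    (h : ∀ v, ∃ x y, f y = 0 ∧ v = f x + g y) {x y : V} (hy : f y = 0)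
    (hxy : f x + g y = 0) : y = 0 := by
  let φ : (LinearMap.range f × LinearMap.ker f) →ₗ[F] V :=
    (LinearMap.range f).subtype.coprod (g ∘ₗ (LinearMap.ker f).subtype)
  have hsurj : Function.Surjective φ := by
    intro v
    obtain ⟨x, y, hy, rfl⟩ := h v
    exact ⟨(⟨f x, x, rfl⟩, ⟨y, hy⟩), by simp [φ]⟩
  -- Rank-nullity: the surjection `φ` joins spaces of equal dimension.
  have hfin : finrank F (LinearMap.range f × LinearMap.ker f) = finrank F V := by
    rw [Module.finrank_prod, f.finrank_range_add_finrank_ker]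
  have hinj : Function.Injective φ :=
    (LinearMap.injective_iff_surjective_of_finrank_eq_finrank hfin).2 hsurj
  have h0 : φ (⟨f x, x, rfl⟩, ⟨y, hy⟩) = φ 0 := by simpa [φ] using hxy
  have := congrArg (fun z => (z.2 : V)) (hinj h0)
  simpa using this

/-- If `g v = f x + g y` with `y ∈ ker f`, then `v - y` lies in the preimage of `range f`. -/
theorem isCompl_comap_range_ker {f g : V →ₗ[F] V}
    (h : ∀ v, ∃ x y, f y = 0 ∧ v = f x + g y) :
    IsCompl ((LinearMap.range f).comap g) (LinearMap.ker f) := by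
  constructor
  · rw [Submodule.disjoint_def]
    rintro x ⟨z, hz⟩ hx
    exact eq_zero_of_apply_add_apply_eq_zero (x := -z) h hx (by simp [hz])
  · rw [codisjoint_iff, eq_top_iff]
    intro v _
    obtain ⟨x, y, hy, hv⟩ := h (g v)
    rw [← sub_add_cancel v y]
    exact Submodule.add_mem_sup ⟨x, by simp [hv]⟩ hy

/-- Bases of domain and codomain in which `f` and `g` take the block forms `diag (1, 0)` and
`diag (C, 1)`. -/
theorem exists_bases_of_range_add_map_ker {f g : V →ₗ[F] V}
    (h : ∀ v, ∃ x y, f y = 0 ∧ v = f x + g y) :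
    ∃ (p r : ℕ) (b c : Basis (Fin p ⊕ (Σ _ : Fin r, Fin 1)) F V) (C : Matrix (Fin p) (Fin p) F),
      (∀ i, f (b (Sum.inl i)) = c (Sum.inl i)) ∧ (∀ j, f (b (Sum.inr j)) = 0) ∧
      (∀ i, g (b (Sum.inl i)) = ∑ l, C l i • c (Sum.inl l)) ∧
      (∀ j, g (b (Sum.inr j)) = c (Sum.inr j)) := by
  have hc := isCompl_comap_range_ker h
  set U := (LinearMap.range f).comap g
  let bU := finBasis F U
  let bN := (finBasis F (LinearMap.ker f)).reindex
    (Equiv.sigmaUnique (Fin (finrank F (LinearMap.ker f))) (fun _ => Fin 1)).symm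
  let b := (bU.prod bN).map (Submodule.prodEquivOfIsCompl U (LinearMap.ker f) hc)
  have hbl : ∀ i, b (Sum.inl i) = (bU i : V) := fun i => by simp [b]
  have hbr : ∀ j, b (Sum.inr j) = (bN j : V) := fun j => by simp [b]
  have hfU : ∀ x, ∃ u : U, f x = f u := by
    intro x
    obtain ⟨u, hu, y, hy, rfl⟩ := Submodule.mem_sup.1 (hc.sup_eq_top ▸ Submodule.mem_top (x := x))
    exact ⟨⟨u, hu⟩, by simp [LinearMap.mem_ker.1 hy]⟩
  -- These vectors span by `h`, and there are `dim V` of them, so they form a basis.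
  let c₀ : Fin (finrank F U) ⊕ (Σ _ : Fin (finrank F (LinearMap.ker f)), Fin 1) → V :=
    Sum.elim (fun i => f (bU i)) (fun j => g (bN j))
  have hfsum : ∀ u : U, f u = ∑ l, bU.repr u l • f (bU l) := by
    intro u
    have := congrArg (f ∘ₗ U.subtype) (bU.sum_repr u)
    simpa only [map_sum, map_smul, LinearMap.comp_apply, Submodule.subtype_apply] using this.symm
  have hspan : ⊤ ≤ Submodule.span F (Set.range c₀) := by
    intro v _
    obtain ⟨x, y, hy, rfl⟩ := h v
    obtain ⟨u, hu⟩ := hfU x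
    have hgy : g y = ∑ l, bN.repr ⟨y, hy⟩ l • g (bN l) := by
      have := congrArg (g ∘ₗ (LinearMap.ker f).subtype) (bN.sum_repr ⟨y, hy⟩)
      simpa only [map_sum, map_smul, LinearMap.comp_apply, Submodule.subtype_apply] using this.symm
    rw [hu, hfsum, hgy]
    exact add_mem
      (Submodule.sum_mem _ fun l _ => Submodule.smul_mem _ _ (Submodule.subset_span ⟨Sum.inl l, rfl⟩))
      (Submodule.sum_mem _ fun l _ => Submodule.smul_mem _ _ (Submodule.subset_span ⟨Sum.inr l, rfl⟩))
  let c := basisOfTopLeSpanOfCardEqFinrank c₀ hspan (finrank_eq_card_basis b).symm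
  have hcc : ∀ i, c i = c₀ i := fun i => by simp [c]
  -- `g` maps `U` into `range f = f(U)`; the coordinates of `u` are a column of `C`.
  have hC : ∀ i, ∃ u : U, g (bU i) = f u := by
    intro i
    obtain ⟨x, hx⟩ := (bU i).2
    obtain ⟨u, hu⟩ := hfU x
    exact ⟨u, by rw [← hu, hx]⟩
  choose w hw using hC
  refine ⟨_, _, b, c, Matrix.of fun l i => bU.repr (w i) l, fun i => ?_, fun j => ?_, fun i => ?_,
    fun j => ?_⟩
  · simp [hcc, hbl, c₀]
  · rw [hbr]; exact (bN j).2
  · simp [hcc, hbl, c₀, hw, ← hfsum]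
  · simp [hcc, hbr, c₀]

end LinearMaps

/-! ### Index at most one and the Weierstrass form -/

theorem nilpotentBlock_one : nilpotentBlock 1 = 0 := by
  ext i j
  simp [nilpotentBlock]

theorem blockDiagonal'_nilpotentBlock_eq_zero {r : ℕ} {σ : Fin r → ℕ} (hσ : ∀ j, σ j = 1) :
    (Matrix.blockDiagonal' fun j => nilpotentBlock (σ j)) = 0 := by
  obtain rfl : σ = fun _ => 1 := funext hσ
  simp only [nilpotentBlock_one]
  exact Matrix.blockDiagonal'_zero

/-- A pencil with a Weierstrass form all of whose nilpotent blocks have size one is regular. -/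
theorem IsWeierstrassForm.isRegularPencil_of_forall_size_eq_one {n p r : ℕ}
    {E A S T : Matrix (Fin n) (Fin n) ℂ}
    {C : Matrix (Fin p) (Fin p) ℂ} {σ : Fin r → ℕ} {e : Fin n ≃ Fin p ⊕ (Σ j : Fin r, Fin (σ j))}
    (h : IsWeierstrassForm E A S T C σ e) (hσ : ∀ j, σ j = 1) : IsRegularPencil E A := by
  -- Up to nonzero factors the determinant of the pencil is the characteristic polynomial of `C`, so
  -- any non-eigenvalue works.
  obtain ⟨z, hz⟩ : ∃ z, C.charpoly.eval z ≠ 0 := by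
    by_contra! hall
    exact C.charpoly_monic.ne_zero (Polynomial.funext fun z => by simpa using hall z)
  refine ⟨z, fun hdet => hz ?_⟩
  have h1 : Matrix.reindex e e (S * (z • E - A) * T) =
      Matrix.fromBlocks (Matrix.scalar _ z - C) 0 0 (-1) := by
    have h2 : Matrix.reindex e e (S * (z • E - A) * T) =
        z • Matrix.reindex e e (S * E * T) - Matrix.reindex e e (S * A * T) := by
      simp [Matrix.mul_sub, Matrix.sub_mul]
      rfl
    rw [h2, h.leading, h.constant, blockDiagonal'_nilpotentBlock_eq_zero hσ,
      Matrix.fromBlocks_smul, sub_eq_add_neg, Matrix.fromBlocks_neg, Matrix.fromBlocks_add]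
    simp [sub_eq_add_neg, Matrix.smul_one_eq_diagonal]
  have h3 := congrArg Matrix.det h1
  rw [Matrix.det_reindex_self, Matrix.det_mul, Matrix.det_mul, hdet,
    Matrix.det_fromBlocks_zero₁₂] at h3
  rw [Matrix.eval_charpoly]
  simpa [Matrix.det_neg] using h3.symm

/-- A pencil `λ E - A` with `range E + A (ker E)` the whole space is regular, with index at most
one. -/
theorem isRegularPencil_and_hasIndex_of_forall_exists {n : ℕ} {E A : Matrix (Fin n) (Fin n) ℂ}
    (h : ∀ v, ∃ x y, E *ᵥ y = 0 ∧ v = E *ᵥ x + A *ᵥ y) :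
    IsRegularPencil E A ∧ ∃ ν ≤ 1, HasIndex E A ν := by
  obtain ⟨p, r, b, c, C, hEl, hEr, hAl, hAr⟩ :=
    exists_bases_of_range_add_map_ker (f := E.mulVecLin) (g := A.mulVecLin) h
  let e : Fin n ≃ Fin p ⊕ (Σ _ : Fin r, Fin 1) := (Pi.basisFun ℂ (Fin n)).indexEquiv b
  let T := (Pi.basisFun ℂ (Fin n)).toMatrix (b.reindex e.symm)
  let T' := (Pi.basisFun ℂ (Fin n)).toMatrix (c.reindex e.symm)
  let S := (c.reindex e.symm).toMatrix (Pi.basisFun ℂ (Fin n))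
  have hST : S * T' = 1 := Basis.toMatrix_mul_toMatrix_flip _ _
  have hTu : IsUnit T := by
    have := Basis.invertibleToMatrix (Pi.basisFun ℂ (Fin n)) (b.reindex e.symm)
    exact isUnit_of_invertible T
  have hSu : IsUnit S := by
    have := Basis.invertibleToMatrix (c.reindex e.symm) (Pi.basisFun ℂ (Fin n))
    exact isUnit_of_invertible S
  have hcol : ∀ (M : Matrix (Fin n) (Fin n) ℂ) (X : Matrix _ _ ℂ),
      (∀ j, M *ᵥ b j = ∑ l, X l j • c l) → Matrix.reindex e e (S * M * T) = X := by
    intro M X hX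
    have : M * T = T' * X.submatrix e e := by
      ext i j
      have h1 := congrFun (hX (e j)) i
      have h2 : (M * T) i j = (M *ᵥ b (e j)) i := by
        simp [T, Matrix.mul_apply, Matrix.mulVec, dotProduct, Basis.toMatrix_apply]
      rw [h2, h1]
      simp only [T', Matrix.mul_apply, Basis.toMatrix_apply, Finset.sum_apply, Pi.smul_apply]
      rw [← e.sum_comp]
      simp [mul_comm]
    rw [Matrix.mul_assoc, this, ← Matrix.mul_assoc, hST, one_mul]
    ext i j
    simp
  have hW : IsWeierstrassForm E A S T C (fun _ => 1) e := by
    refine ⟨hSu, hTu, fun _ => le_rfl, hcol _ _ ?_, hcol _ _ ?_⟩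
    · rw [blockDiagonal'_nilpotentBlock_eq_zero (σ := fun _ : Fin r => 1) fun _ => rfl]
      rintro (i | j)
      · simpa [Matrix.one_apply] using hEl i
      · simpa using hEr j
    · rintro (i | j)
      · simpa using hAl i
      · simpa [Matrix.one_apply] using hAr j
  exact ⟨hW.isRegularPencil_of_forall_size_eq_one fun _ => rfl, _,
    Finset.sup_le fun _ _ => le_rfl, p, r, S, T, C, _, e, hW, rfl⟩

theorem HasIndex.exists_mulVec_add_mulVec {n ν : ℕ} {E A : Matrix (Fin n) (Fin n) ℂ}
    (h : HasIndex E A ν) (hν : ν ≤ 1) (v : Fin n → ℂ) :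
    ∃ x y, E *ᵥ y = 0 ∧ v = E *ᵥ x + A *ᵥ y := by
  obtain ⟨p, r, S, T, C, σ, e, hW, rfl⟩ := h
  have hσ : ∀ j, σ j = 1 := fun j =>
    le_antisymm ((Finset.le_sup (f := σ) (Finset.mem_univ j)).trans hν) (hW.size_pos j)
  have hlead := hW.leading
  rw [blockDiagonal'_nilpotentBlock_eq_zero hσ, ← Equiv.eq_symm_apply] at hlead
  have hconst := hW.constant
  rw [← Equiv.eq_symm_apply] at hconst
  have hS : Function.Injective S.mulVec := Matrix.mulVec_injective_iff_isUnit.2 hW.isUnit_left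
  have key : ∀ (M : Matrix (Fin n) (Fin n) ℂ) (X : Matrix _ _ ℂ),
      S * M * T = (Matrix.reindex e e).symm X → ∀ w : _ → ℂ,
      S *ᵥ (M *ᵥ (T *ᵥ (w ∘ e))) = (X *ᵥ w) ∘ e := by
    intro M X hX w
    rw [Matrix.mulVec_mulVec, Matrix.mulVec_mulVec, hX]
    simp [Matrix.submatrix_mulVec_equiv, Function.comp_assoc]
  set w := (S *ᵥ v) ∘ e.symm with hw
  -- In Weierstrass coordinates the pair is `diag (1, 0)`, `diag (C, 1)`: the finite components of
  -- `S v` give `x`, the infinite ones `y`.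
  refine ⟨T *ᵥ (Sum.elim (w ∘ Sum.inl) 0 ∘ e), T *ᵥ (Sum.elim 0 (w ∘ Sum.inr) ∘ e), hS ?_, hS ?_⟩
  · rw [key _ _ hlead]
    ext i
    simp [Matrix.fromBlocks_mulVec]
  · rw [Matrix.mulVec_add, key _ _ hlead, key _ _ hconst]
    ext i
    have hi : (S *ᵥ v) i = w (e i) := by simp [hw]
    rw [hi]
    simp only [Pi.add_apply, Function.comp_apply]
    rcases e i with a | a <;> simp [Matrix.fromBlocks_mulVec]

/-! ### Rank, kernel and range under output feedback -/

section FeedbackRank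

variable {n m : ℕ} {E : Matrix (Fin n) (Fin n) ℂ} {B : Matrix (Fin n) (Fin m) ℂ}

theorem add_mul_mul_conjTranspose_eq_fromCols_mul (K : Matrix (Fin m) (Fin m) ℂ) :
    E + B * K * Bᴴ = Matrix.fromCols E B * Matrix.fromRows (1 : Matrix (Fin n) (Fin n) ℂ) (K * Bᴴ) := by
  rw [Matrix.fromCols_mul_fromRows, Matrix.mul_one, Matrix.mul_assoc]

theorem rank_add_mul_mul_conjTranspose_le (K : Matrix (Fin m) (Fin m) ℂ) :
    (E + B * K * Bᴴ).rank ≤ (Matrix.fromCols E B).rank := by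
  rw [add_mul_mul_conjTranspose_eq_fromCols_mul]
  exact Matrix.rank_mul_le_left _ _

theorem rank_fromRows_conjTranspose (hE : E.IsHermitian) :
    (Matrix.fromRows E Bᴴ).rank = (Matrix.fromCols E B).rank := by
  rw [← Matrix.rank_conjTranspose (Matrix.fromCols E B),
    Matrix.conjTranspose_fromCols_eq_fromRows_conjTranspose, hE.eq]

theorem ker_fromRows_le_ker_add (K : Matrix (Fin m) (Fin m) ℂ) :
    LinearMap.ker (Matrix.fromRows E Bᴴ).mulVecLin ≤ LinearMap.ker (E + B * K * Bᴴ).mulVecLin := by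
  intro x hx
  have hx' : Sum.elim (E *ᵥ x) (Bᴴ *ᵥ x) = 0 := by
    simpa [Matrix.fromRows_mulVec] using hx
  have h1 : E *ᵥ x = 0 := funext fun i => congrFun hx' (Sum.inl i)
  have h2 : Bᴴ *ᵥ x = 0 := funext fun i => congrFun hx' (Sum.inr i)
  rw [LinearMap.mem_ker, Matrix.mulVecLin_apply, Matrix.add_mulVec, ← Matrix.mulVec_mulVec, h1, h2,
    Matrix.mulVec_zero, add_zero]

theorem ker_add_eq_ker_fromRows (hE : E.IsHermitian) {K : Matrix (Fin m) (Fin m) ℂ}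
    (hK : (E + B * K * Bᴴ).rank = (Matrix.fromCols E B).rank) :
    LinearMap.ker (E + B * K * Bᴴ).mulVecLin = LinearMap.ker (Matrix.fromRows E Bᴴ).mulVecLin := by
  refine (Submodule.eq_of_le_of_finrank_eq (ker_fromRows_le_ker_add K) ?_).symm
  have h1 := (E + B * K * Bᴴ).mulVecLin.finrank_range_add_finrank_ker
  have h2 := (Matrix.fromRows E Bᴴ).mulVecLin.finrank_range_add_finrank_ker
  have h3 := rank_fromRows_conjTranspose (B := B) hE
  rw [← hK] at h3
  simp only [Matrix.rank] at h3
  omega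

theorem range_add_eq_range_fromCols {K : Matrix (Fin m) (Fin m) ℂ}
    (hK : (E + B * K * Bᴴ).rank = (Matrix.fromCols E B).rank) :
    LinearMap.range (E + B * K * Bᴴ).mulVecLin =
      LinearMap.range (Matrix.fromCols E B).mulVecLin := by
  refine Submodule.eq_of_le_of_finrank_eq ?_ hK
  rw [add_mul_mul_conjTranspose_eq_fromCols_mul, Matrix.mulVecLin_mul]
  exact LinearMap.range_comp_le_range _ _

theorem posSemidef_add_mul_conjTranspose (hE : E.PosSemidef) : (E + B * (1 : Matrix (Fin m) (Fin m) ℂ) * Bᴴ).PosSemidef := by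
  rw [Matrix.mul_one]
  exact hE.add (Matrix.posSemidef_self_mul_conjTranspose B)

/-- If `(E + B Bᴴ) x = 0`, the nonnegative numbers `xᴴ E x` and `xᴴ B Bᴴ x` sum to zero, so both
vanish and `x` is killed by `E` and `Bᴴ`. -/
theorem rank_add_mul_conjTranspose (hE : E.PosSemidef) :
    (E + B * (1 : Matrix (Fin m) (Fin m) ℂ) * Bᴴ).rank = (Matrix.fromCols E B).rank := by
  rw [← rank_fromRows_conjTranspose hE.isHermitian]
  have hker : LinearMap.ker (E + B * (1 : Matrix (Fin m) (Fin m) ℂ) * Bᴴ).mulVecLin =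
      LinearMap.ker (Matrix.fromRows E Bᴴ).mulVecLin := by
    refine le_antisymm (fun x hx => ?_) (ker_fromRows_le_ker_add 1)
    have hx' : E *ᵥ x + (B * Bᴴ) *ᵥ x = 0 := by
      simpa [Matrix.add_mulVec] using hx
    have hsum : star x ⬝ᵥ E *ᵥ x + star x ⬝ᵥ (B * Bᴴ) *ᵥ x = 0 := by
      rw [← dotProduct_add, hx', dotProduct_zero]
    have hB := Matrix.posSemidef_self_mul_conjTranspose B
    obtain ⟨h1, h2⟩ := (add_eq_zero_iff_of_nonneg (hE.dotProduct_mulVec_nonneg x)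
      (hB.dotProduct_mulVec_nonneg x)).1 hsum
    have h3 : E *ᵥ x = 0 := (hE.dotProduct_mulVec_zero_iff x).1 h1
    have h4 : Bᴴ *ᵥ x = 0 := (Matrix.self_mul_conjTranspose_mulVec_eq_zero B x).1
      ((hB.dotProduct_mulVec_zero_iff x).1 h2)
    simp [Matrix.fromRows_mulVec, h3, h4]
  have h1 := (E + B * (1 : Matrix (Fin m) (Fin m) ℂ) * Bᴴ).mulVecLin.finrank_range_add_finrank_ker
  have h2 := (Matrix.fromRows E Bᴴ).mulVecLin.finrank_range_add_finrank_ker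
  rw [hker] at h1
  simp only [Matrix.rank]
  omega

end FeedbackRank

theorem rank_eq_iff_forall_exists_mulVec {n : ℕ} {ι : Type*} [Fintype ι]
    {M : Matrix (Fin n) ι ℂ} : M.rank = n ↔ ∀ v, ∃ x, M *ᵥ x = v := by
  have hn : finrank ℂ (Fin n → ℂ) = n := by simp
  have h : M.rank = n ↔ LinearMap.range M.mulVecLin = ⊤ := by
    constructor
    · intro h
      exact Submodule.eq_top_of_finrank_eq (by rw [hn]; exact h)
    · intro h
      rw [Matrix.rank, h, finrank_top, hn]
  rw [h, LinearMap.range_eq_top]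
  rfl

/-- The rank condition says that the range of `E + B K Bᴴ` and the image of its kernel under `A`
span the space. -/
theorem rank_fromCols_eq_iff {n m k : ℕ} {E A : Matrix (Fin n) (Fin n) ℂ}
    {B : Matrix (Fin n) (Fin m) ℂ} (hE : E.IsHermitian) {K : Matrix (Fin m) (Fin m) ℂ}
    (hK : (E + B * K * Bᴴ).rank = (Matrix.fromCols E B).rank) {S : Matrix (Fin n) (Fin k) ℂ}
    (hS : IsNullspaceMatrix (Matrix.fromRows E Bᴴ) S) :
    (Matrix.fromCols E (Matrix.fromCols (A * S) B)).rank = n ↔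
      ∀ v, ∃ x y, (E + B * K * Bᴴ) *ᵥ y = 0 ∧ v = (E + B * K * Bᴴ) *ᵥ x + A *ᵥ y := by
  have hker : ∀ y, (E + B * K * Bᴴ) *ᵥ y = 0 ↔ ∃ s, S *ᵥ s = y := by
    intro y
    have h1 : (E + B * K * Bᴴ) *ᵥ y = 0 ↔ y ∈ LinearMap.ker (E + B * K * Bᴴ).mulVecLin := Iff.rfl
    rw [h1, ker_add_eq_ker_fromRows hE hK, ← hS.2, ← Matrix.range_mulVecLin]
    rfl
  have hran := range_add_eq_range_fromCols hK
  rw [rank_eq_iff_forall_exists_mulVec]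
  refine forall_congr' fun v => ⟨?_, ?_⟩
  · rintro ⟨x, rfl⟩
    -- The `E` and `B` columns together contribute a vector of `range [E B]`, hence of the range of
    -- `E + B K Bᴴ`.
    have hmem : Matrix.fromCols E B *ᵥ Sum.elim (x ∘ Sum.inl) (x ∘ Sum.inr ∘ Sum.inr) ∈
        LinearMap.range (E + B * K * Bᴴ).mulVecLin := hran ▸ ⟨_, rfl⟩
    obtain ⟨z, hz⟩ := hmem
    refine ⟨z, S *ᵥ (x ∘ Sum.inr ∘ Sum.inl), (hker _).2 ⟨_, rfl⟩, ?_⟩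
    rw [Matrix.mulVecLin_apply] at hz
    rw [hz]
    simp only [Matrix.fromCols_mulVec, Matrix.mulVec_mulVec, Sum.elim_comp_inl, Sum.elim_comp_inr,
      Function.comp_assoc]
    abel
  · rintro ⟨x, y, hy, rfl⟩
    obtain ⟨s, rfl⟩ := (hker y).1 hy
    have hmem : (E + B * K * Bᴴ) *ᵥ x ∈ LinearMap.range (Matrix.fromCols E B).mulVecLin :=
      hran ▸ ⟨x, rfl⟩
    obtain ⟨z, hz⟩ := hmem
    refine ⟨Sum.elim (z ∘ Sum.inl) (Sum.elim s (z ∘ Sum.inr)), ?_⟩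
    rw [← hz, Matrix.mulVecLin_apply]
    simp only [Matrix.fromCols_mulVec, Matrix.mulVec_mulVec, Sum.elim_comp_inl, Sum.elim_comp_inr]
    abel

end PHDAE

theorem mainTheorem9 {n m : ℕ} (E J R : Matrix (Fin n) (Fin n) ℂ)
    (B : Matrix (Fin n) (Fin m) ℂ)
    (hE : E.PosSemidef) (hR : R.PosSemidef) (hJ : J = -Jᴴ) :
    IsGreatest
        (Set.range fun Khat : Matrix (Fin m) (Fin m) ℂ => (E + B * Khat * Bᴴ).rank)
        (Matrix.fromCols E B).rank ∧
      ∀ (k : ℕ) (S : Matrix (Fin n) (Fin k) ℂ),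
        PHDAE.IsNullspaceMatrix (Matrix.fromRows E Bᴴ) S →
          ((∃ K : Matrix (Fin m) (Fin m) ℂ,
              (E + B * K * Bᴴ).PosSemidef ∧
              PHDAE.IsRegularPencil (E + B * K * Bᴴ) (J - R) ∧
              (∃ ν : ℕ, ν ≤ 1 ∧ PHDAE.HasIndex (E + B * K * Bᴴ) (J - R) ν) ∧
              (E + B * K * Bᴴ).rank = (Matrix.fromCols E B).rank) ↔
            (Matrix.fromCols E (Matrix.fromCols ((J - R) * S) B)).rank = n) := by
  refine ⟨⟨⟨1, PHDAE.rank_add_mul_conjTranspose hE⟩, ?_⟩, fun k S hS => ⟨?_, fun h => ?_⟩⟩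
  · rintro _ ⟨K, rfl⟩
    exact PHDAE.rank_add_mul_mul_conjTranspose_le K
  · rintro ⟨K, -, -, ⟨ν, hν, hindex⟩, hK⟩
    exact (PHDAE.rank_fromCols_eq_iff hE.isHermitian hK hS).2
      (hindex.exists_mulVec_add_mulVec hν)
  · have hK := PHDAE.rank_add_mul_conjTranspose (B := B) hE
    obtain ⟨hreg, hindex⟩ := PHDAE.isRegularPencil_and_hasIndex_of_forall_exists
      ((PHDAE.rank_fromCols_eq_iff hE.isHermitian hK hS).1 h)
    exact ⟨1, PHDAE.posSemidef_add_mul_conjTranspose hE, hreg, hindex, hK⟩
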